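/- Let $p\ge 3$ be a prime. For $m\ge 0$ call a string $b_0b_1\cdots b_{m-1}$ of $m$ elements of $\mathbb{Z}/p$ accessible if, for some $k\ge 0$, it occurs as a contiguous substring of the string of coefficients (ordered by powers of the variable, from the constant term to the leading term) of $(1+X)^k$ reduced modulo $p$. Let $a(m)=a_{1+X,p}(m)$ be the number of accessible strings of length $m$ (so $a(0)=1$). Let $x$ be a real number with $\frac1p\le x\le 1$, and for $k\ge 0$ put $n_k=\lfloor p^k/x\rfloor$. Then, with $x$ fixed and $k\to\infty$, the sequence $a(n_k)/n_k^2$ converges, and $$\lim_{k\to\infty}\frac{a(n_k)}{n_k^2}=\begin{cases} \displaystyle\frac{p^2(p-5)(p-1)}{2(p+1)}\Big(x+\frac{p+1}{p(p-5)}\Big)^2+\frac{(p-1)(p^2-7p+4)}{2(p-5)}, & \frac1p\le x\le\frac13,\ p\ne 5,\\[1em] 20x+8, & \frac1p\le x\le\frac13,\ p=5,\\[1em] \displaystyle-\frac{(p-1)(7p^3-8p^2-9p+18)}{4(p+1)}\Big(x-\frac{(p+1)(3p^2-7p+6)}{7p^3-8p^2-9p+18}\Big)^2+\frac{(p-1)(p^5+5p^4-8p^3-15p^2+39p-18)}{2(7p^3-8p^2-9p+18)},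 & \frac13\le x\le\frac12,\\[1em] \displaystyle\frac{(p-2)(p-1)(p^2+2p+5)}{4(p+1)}\Big(x-\frac{(p+1)^2}{p^2+2p+5}\Big)^2+\frac{(p-1)(p^3+4p^2+3p-4)}{2(p^2+2p+5)}, & \frac12\le x\le 1. \end{cases}$$ At the common endpoints $x=\frac13$ and $x=\frac12$ both of the applicable formulas hold. -/

import Mathlib

open Filter Topology Polynomial

/-- Row `k` of `f` modulo `p`: the `k`-th power of the reduction of `f` modulo `p`. Its entries
are the coefficients, from the constant term up to the leading one. -/
noncomputable def rowPoly (f : ℤ[X]) (p k : ℕ) : (ZMod p)[X] :=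
  (f.map (Int.castRingHom (ZMod p))) ^ k

/-- An `m`-block `b` (a string of `m` digits modulo `p`) is accessible if, for some `k`, it occurs
as a contiguous substring of the finite string of coefficients
`c₀ c₁ … c_d`, `d = deg`, of the `k`-th power of `f` modulo `p`. -/
def IsAccessibleBlock (f : ℤ[X]) (p : ℕ) {m : ℕ} (b : Fin m → ZMod p) : Prop :=
  ∃ k i : ℕ, i + m ≤ (rowPoly f p k).natDegree + 1 ∧
    ∀ j : Fin m, b j = (rowPoly f p k).coeff (i + (j : ℕ))

/-- The line complexity: the number of accessible `m`-blocks of `f` modulo `p`.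
(For `m = 0` the only block is the empty one, which is accessible, so the value is `1`.) -/
noncomputable def lineComplexity (f : ℤ[X]) (p m : ℕ) : ℕ :=
  Set.ncard {b : Fin m → ZMod p | IsAccessibleBlock f p b}

/-!
By Lucas' theorem, row `p * q + r` of Pascal's triangle modulo `p` (`r < p`) arises from row `q` by
replacing each entry `c` by the string of the `p` entries `c * r.choose v`, `v < p`; if `c ≠ 0`, these
vanish exactly for `v > r`. Hence the blocks of length `m` that start at index `t` of a string in a row
congruent to `r` correspond bijectively to the accessible blocks of length `sourceLength p m r t`
(`ncard_residueBlocks_eq`). Copies of a row separated by long runs of zeros occur further down, so it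
does not matter that an accessible block has to lie inside its row (`isAccessibleBlock_iff`).

To count accessible blocks, one has to know how often a block arises from several pairs `(r, t)`.
Since `f = (1 + X) ^ k` satisfies `(1 + X) f' = k f`, the entries of a block satisfy
`(T + j + 1) * b (j + 1) = (R - T - j) * b j`, where `R` and `T` are the residues of the row and of
the position. For length at least `3` this determines `(R, T)` unless the block is zero or a multiple
of `1, 0, …, 0`, of `0, …, 0, 1` or of `1, -1, 1, …` (`eq_of_mem_residueBlocks`). The exceptional
blocks contribute the constant `(p - 1) * (4 * p - 2)`, and a recurrence for the number `a` of
accessible blocks follows (`blockCount_recurrence`).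

For the differences `d m = a (m + 1) - a m` the recurrence reads
`d (p * n + s) = (p - s) * d n + s * d (n + 1)` (`blockSlope_mul_add`), so `d` interpolates linearly
between the multiples of `p ^ k`, where `d (p ^ k * c) = p ^ k * d c`. The values `d 1`, `d 2`, and
`d c` for `3 ≤ c ≤ p`, which are affine in `c`, then make `a` an explicit quadratic polynomial on each
of the intervals `[p ^ k, 2 * p ^ k]`, `[2 * p ^ k, 3 * p ^ k]` and `[3 * p ^ k, p ^ (k + 1)]`
(`blockCount_pow_mul_add`, `blockCount_pow`). These correspond to the three ranges of `x`, and the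
limits are read off from the quadratic parts (`tendsto_blockCount`).
-/

/-- The blocks of length `m` occurring in some row `k` of Pascal's triangle modulo `p`, where the
row is continued to the right by zeros. -/
def binomBlocks (p m : ℕ) : Set (Fin m → ZMod p) :=
  {b | ∃ k i : ℕ, ∀ j : Fin m, b j = (k.choose (i + j) : ZMod p)}

/-- The blocks of `binomBlocks p m` that occur in a row `k` with `k = R` in `ZMod p`, at a position
`i` with `i = T` in `ZMod p`. -/
def residueBlocks (p m : ℕ) (R T : ZMod p) : Set (Fin m → ZMod p) :=
  {b | ∃ k i : ℕ, (k : ZMod p) = R ∧ (i : ZMod p) = T ∧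
    ∀ j : Fin m, b j = (k.choose (i + j) : ZMod p)}

/-! ### Lucas' theorem and zero padding -/

theorem rowPoly_one_add_X (p k : ℕ) : rowPoly (1 + X) p k = (1 + X) ^ k := by
  simp [rowPoly]

section Lucas
variable {p : ℕ} [Fact p.Prime]

theorem choose_mul_add_cast (q u : ℕ) {r v : ℕ} (hr : r < p) (hv : v < p) :
    ((p * q + r).choose (p * u + v) : ZMod p) = q.choose u * r.choose v := by
  have hp : 0 < p := (Fact.out : p.Prime).pos
  have h := Choose.choose_modEq_choose_mod_mul_choose_div_nat (n := p * q + r) (k := p * u + v)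
    (p := p)
  rw [← ZMod.natCast_eq_natCast_iff] at h
  rw [h, Nat.mul_add_mod, Nat.mul_add_mod, Nat.mod_eq_of_lt hr, Nat.mod_eq_of_lt hv,
    Nat.mul_add_div hp, Nat.mul_add_div hp, Nat.div_eq_of_lt hr, Nat.div_eq_of_lt hv]
  push_cast
  rw [add_zero, add_zero, mul_comm]

theorem choose_pow_mul_add_cast (N q u : ℕ) {r v : ℕ} (hr : r < p ^ N) (hv : v < p ^ N) :
    ((p ^ N * q + r).choose (p ^ N * u + v) : ZMod p) = q.choose u * r.choose v := by
  have hp : 0 < p := (Fact.out : p.Prime).pos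
  induction N generalizing q u r v with
  | zero =>
    obtain rfl : r = 0 := by simpa using hr
    obtain rfl : v = 0 := by simpa using hv
    simp
  | succ N ih =>
    have key : ∀ x y, p ^ (N + 1) * x + y = p * (p ^ N * x + y / p) + y % p := fun x y => by
      rw [pow_succ', mul_add, mul_assoc, add_assoc, Nat.div_add_mod]
    have hlt : ∀ y, y < p ^ (N + 1) → y / p < p ^ N := fun y hy =>
      Nat.div_lt_of_lt_mul (by rwa [pow_succ'] at hy)
    rw [key, key, choose_mul_add_cast _ _ (Nat.mod_lt _ hp) (Nat.mod_lt _ hp),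
      ih _ _ (hlt r hr) (hlt v hv), mul_assoc,
      ← choose_mul_add_cast _ _ (Nat.mod_lt _ hp) (Nat.mod_lt _ hp), Nat.div_add_mod,
      Nat.div_add_mod]

theorem choose_pow_sub_one_cast (N : ℕ) {v : ℕ} (hv : v < p ^ N) :
    ((p ^ N - 1).choose v : ZMod p) = (-1) ^ v := by
  induction v with
  | zero => simp
  | succ v ih =>
    have hpos : p ^ N - 1 + 1 = p ^ N := by omega
    have h := Nat.choose_succ_succ (p ^ N - 1) v
    rw [Nat.succ_eq_add_one, hpos] at h
    have h0 : ((p ^ N).choose (v + 1) : ZMod p) = 0 :=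
      (ZMod.natCast_eq_zero_iff _ _).2
        ((Fact.out : p.Prime).dvd_choose_pow (Nat.succ_ne_zero v) hv.ne)
    have h' := congrArg (Nat.cast (R := ZMod p)) h
    rw [Nat.succ_eq_add_one, h0] at h'
    push_cast at h'
    rw [ih (by omega)] at h'
    rw [pow_succ]
    linear_combination -h'

/-- Adding a large power of `p` to the row index puts a second copy of the row after the zeros that
follow it, so a zero padding on the right does not produce new blocks. -/
theorem isAccessibleBlock_iff {m : ℕ} (b : Fin m → ZMod p) :
    IsAccessibleBlock (1 + X) p b ↔ b ∈ binomBlocks p m := by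
  have hdeg : ∀ k, ((1 + X : (ZMod p)[X]) ^ k).natDegree = k := fun k => by
    rw [natDegree_pow, add_comm, ← C_1, natDegree_X_add_C, mul_one]
  simp only [IsAccessibleBlock, rowPoly_one_add_X, hdeg, coeff_one_add_X_pow, binomBlocks,
    Set.mem_ofPred_eq]
  constructor
  · rintro ⟨k, i, -, h⟩
    exact ⟨k, i, h⟩
  · rintro ⟨k, i, h⟩
    have hN : k + i + m < p ^ (k + i + m) :=
      Nat.lt_pow_self (Fact.out : p.Prime).one_lt
    refine ⟨p ^ (k + i + m) * 1 + k, i, by omega, fun j => ?_⟩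
    have := choose_pow_mul_add_cast (p := p) (k + i + m) 1 0 (r := k) (v := i + j) (by omega)
      (by omega)
    rw [h, ← zero_add (i + (j : ℕ)), ← mul_zero (p ^ (k + i + m)), this]
    simp

theorem lineComplexity_eq (m : ℕ) :
    lineComplexity (1 + X) p m = (binomBlocks p m).ncard := by
  simp only [lineComplexity, isAccessibleBlock_iff, Set.ofPred_mem_eq]

/-- Every block occurs away from the left end of a row. -/
theorem exists_pos_of_mem_binomBlocks {m : ℕ} {b : Fin m → ZMod p} (hb : b ∈ binomBlocks p m) :
    ∃ k i : ℕ, 0 < i ∧ ∀ j : Fin m, b j = (k.choose (i + j) : ZMod p) := by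
  obtain ⟨k, i, h⟩ := hb
  have hN : k + i + m < p ^ (k + i + m) := Nat.lt_pow_self (Fact.out : p.Prime).one_lt
  refine ⟨p ^ (k + i + m) * 1 + k, p ^ (k + i + m) * 1 + i, by omega, fun j => ?_⟩
  rw [add_assoc (p ^ (k + i + m) * 1), choose_pow_mul_add_cast (p := p) _ _ _
    (by omega) (by omega), h]
  simp

end Lucas

/-! ### The number of blocks with prescribed residues -/

section Residues
variable {p : ℕ} [Fact p.Prime]

/-- Row `p * q + r` arises from row `q` by replacing each entry `c` by the string of the entries
`c * r.choose v`, `v < p`. The hypotheses say that a window of length `m` whose first entry has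
index `T.val` in its string meets the strings of exactly `L` entries of row `q` in a position where
`R.val.choose v` does not vanish, and that the first `δ` strings met contribute zeros only. -/
theorem ncard_residueBlocks {m L δ : ℕ} (R T : ZMod p) (hδ : δ ≤ 1)
    (hzero : ∀ j < m, (T.val + j) / p < δ → R.val.choose ((T.val + j) % p) = 0)
    (hlt : ∀ j < m, (T.val + j) / p < L + δ)
    (hseen : ∀ u < L, ∃ j < m, (T.val + j) / p = u + δ ∧ (T.val + j) % p ≤ R.val) :
    (residueBlocks p m R T).ncard = (binomBlocks p L).ncard := by
  have hp : 0 < p := (Fact.out : p.Prime).pos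
  have hR : R.val < p := ZMod.val_lt R
  have hT : T.val < p := ZMod.val_lt T
  let φ : (Fin L → ZMod p) → (Fin m → ZMod p) := fun w j =>
    (R.val.choose ((T.val + j) % p) : ZMod p) *
      if h : (T.val + j) / p - δ < L then w ⟨(T.val + j) / p - δ, h⟩ else 0
  have hφ : Function.Injective φ := by
    intro w w' hw
    funext u
    obtain ⟨j, hj, h1, h2⟩ := hseen u u.2
    have h := congrFun hw ⟨j, hj⟩
    have hu : (T.val + j) / p - δ = u := by omega
    have hne : (R.val.choose ((T.val + j) % p) : ZMod p) ≠ 0 := by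
      rw [Ne, ZMod.natCast_eq_zero_iff]
      intro hd
      have hd' : p ∣ R.val.factorial := by
        rw [← Nat.choose_mul_factorial_mul_factorial h2, mul_assoc]
        exact hd.mul_right _
      exact absurd (((Fact.out : p.Prime).dvd_factorial).1 hd') (by omega)
    simp only [φ, hu, u.2, dif_pos, Fin.eta] at h
    exact mul_left_cancel₀ hne h
  -- the substitution rule, at the position with string number `s` and index `T.val` in the string
  have hsub : ∀ q s j : ℕ, ((p * q + R.val).choose (p * s + T.val + j) : ZMod p) =
      q.choose (s + (T.val + j) / p) * R.val.choose ((T.val + j) % p) := by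
    intro q s j
    rw [← choose_mul_add_cast _ _ hR (Nat.mod_lt _ hp), add_assoc (p * s) T.val, mul_add,
      add_assoc (p * s) (p * _), Nat.div_add_mod]
  have himage : residueBlocks p m R T = φ '' binomBlocks p L := by
    ext b
    constructor
    · rintro ⟨k, i, hk, hi, hb⟩
      have hk' : k = p * (k / p) + R.val := by
        rw [← hk, ZMod.val_natCast, Nat.div_add_mod]
      have hi' : i = p * (i / p) + T.val := by
        rw [← hi, ZMod.val_natCast, Nat.div_add_mod]
      refine ⟨fun u => ((k / p).choose (i / p + δ + u) : ZMod p), ⟨_, _, fun _ => rfl⟩, ?_⟩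
      funext j
      rw [hb, hk', hi', hsub]
      rcases lt_or_ge ((T.val + j) / p) δ with h | h
      · simp [φ, hzero j j.2 h]
      · have h1 := hlt j j.2
        have h2 : (T.val + j) / p - δ < L := by omega
        have h3 : i / p + δ + ((T.val + (j : ℕ)) / p - δ) = i / p + (T.val + j) / p := by omega
        simp only [φ, h2, dif_pos]
        rw [← hk', ← hi', mul_comm, h3]
    · rintro ⟨w, hw, rfl⟩
      obtain ⟨q, i, hi, hw⟩ := exists_pos_of_mem_binomBlocks hw
      refine ⟨p * q + R.val, p * (i - δ) + T.val, by simp, by simp, fun j => ?_⟩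
      rw [hsub]
      rcases lt_or_ge ((T.val + j) / p) δ with h | h
      · simp [φ, hzero j j.2 h]
      · have h1 := hlt j j.2
        have h2 : (T.val + j) / p - δ < L := by omega
        have h3 : i - δ + (T.val + (j : ℕ)) / p = i + ((T.val + j) / p - δ) := by omega
        simp only [φ, h2, dif_pos, hw, h3]
        rw [mul_comm]
  rw [himage, Set.ncard_image_of_injective _ hφ]

/-- The number of entries of row `q` that a window of length `m` in row `p * q + r` determines, if
its first entry has index `t` in its string. -/
def sourceLength (p m r t : ℕ) : ℕ :=
  if t ≤ r then (m + t + p - 1) / p else (m + t + p - 1) / p - 1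

theorem ncard_residueBlocks_eq {m : ℕ} (hm : 0 < m) (R T : ZMod p) :
    (residueBlocks p m R T).ncard = (binomBlocks p (sourceLength p m R.val T.val)).ncard := by
  have hp : 0 < p := (Fact.out : p.Prime).pos
  have hT : T.val < p := ZMod.val_lt T
  have hlast : ∀ j < m, (T.val + j) / p < (m + T.val + p - 1) / p := fun j hj => by
    rw [Nat.div_lt_iff_lt_mul hp]
    have := Nat.lt_div_mul_add hp (a := m + T.val + p - 1)
    omega
  have hstart : ∀ u, 0 < u → u < (m + T.val + p - 1) / p →
      ∃ j < m, (T.val + j) / p = u ∧ (T.val + j) % p = 0 := fun u hu hu' => by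
    have h1 : (u + 1) * p ≤ m + T.val + p - 1 := (Nat.le_div_iff_mul_le hp).1 hu'
    have h2 : p ≤ u * p := Nat.le_mul_of_pos_left p hu
    have h3 : T.val + (u * p - T.val) = u * p := by omega
    refine ⟨u * p - T.val, ?_, ?_, ?_⟩
    · rw [add_mul] at h1
      omega
    · rw [h3, Nat.mul_div_cancel _ hp]
    · rw [h3, Nat.mul_mod_left]
  by_cases h : T.val ≤ R.val
  · rw [sourceLength, if_pos h]
    refine ncard_residueBlocks (δ := 0) R T (by omega)
      (fun j _ hj => absurd hj (Nat.not_lt_zero _)) (by simpa using hlast) ?_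
    intro u hu
    rcases Nat.eq_zero_or_pos u with rfl | hu0
    · exact ⟨0, hm, by simp [Nat.div_eq_of_lt hT], by simpa [Nat.mod_eq_of_lt hT] using h⟩
    · obtain ⟨j, hj, h1, h2⟩ := hstart u hu0 hu
      exact ⟨j, hj, h1, by omega⟩
  · rw [sourceLength, if_neg h]
    refine ncard_residueBlocks (δ := 1) R T le_rfl ?_ ?_ ?_
    · intro j hj hj'
      have h1 : T.val + j < p := by
        by_contra hge
        have := Nat.div_pos (not_lt.1 hge) hp
        omega
      rw [Nat.mod_eq_of_lt h1]
      exact Nat.choose_eq_zero_of_lt (by omega)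
    · intro j hj
      have := hlast j hj
      omega
    · intro u hu
      obtain ⟨j, hj, h1, h2⟩ := hstart (u + 1) (by omega) (by omega)
      exact ⟨j, hj, h1, by omega⟩

end Residues

/-! ### How many residues a block admits -/

/-- The nonzero multiples of a block. -/
def nonzeroMultiples {p n : ℕ} (v : Fin n → ZMod p) : Set (Fin n → ZMod p) :=
  {b | ∃ c : ZMod p, c ≠ 0 ∧ b = c • v}

/-- The block `1, -1, 1, …`. -/
def alternatingBlock (p n : ℕ) : Fin n → ZMod p := fun j => (-1) ^ (j : ℕ)

section Multiplicity
variable {p : ℕ} [Fact p.Prime]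

theorem ncard_nonzeroMultiples {n : ℕ} {v : Fin n → ZMod p} (hv : v ≠ 0) :
    (nonzeroMultiples v).ncard = p - 1 := by
  have h : nonzeroMultiples v = (fun c : ZMod p => c • v) '' {0}ᶜ := by
    ext b
    simp only [nonzeroMultiples, Set.mem_ofPred_eq, Set.mem_image, Set.mem_compl_iff,
      Set.mem_singleton_iff]
    exact exists_congr fun c => and_congr_right fun _ => eq_comm
  rw [h, Set.ncard_image_of_injective _ (smul_left_injective _ hv), Set.ncard_compl,
    Set.ncard_singleton, Nat.card_zmod]

/-- Consecutive entries of a row satisfy a linear recurrence: `(1 + X) f' = k f` for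
`f = (1 + X) ^ k`. -/
theorem residueBlocks_recurrence {n : ℕ} {R T : ZMod p} {b : Fin (n + 1) → ZMod p}
    (hb : b ∈ residueBlocks p (n + 1) R T) (j : Fin n) :
    (T + (j : ℕ) + 1) * b j.succ = (R - T - (j : ℕ)) * b j.castSucc := by
  obtain ⟨k, i, rfl, rfl, h⟩ := hb
  rw [h, h, Fin.val_succ, Fin.val_castSucc, ← add_assoc]
  have := congrArg (Nat.cast (R := ZMod p)) (Nat.choose_succ_right_eq k (i + j))
  rcases le_or_gt (i + (j : ℕ)) k with hle | hlt
  · push_cast [Nat.cast_sub hle] at this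
    linear_combination this
  · rw [Nat.choose_eq_zero_of_lt hlt, Nat.choose_eq_zero_of_lt (by omega)]
    simp

theorem zero_mem_residueBlocks (m : ℕ) (R T : ZMod p) : 0 ∈ residueBlocks p m R T :=
  ⟨R.val, p * (R.val + 1) + T.val, by simp, by simp, fun j => by
    have : R.val + 1 ≤ p * (R.val + 1) := Nat.le_mul_of_pos_left _ (Fact.out : p.Prime).pos
    rw [Nat.choose_eq_zero_of_lt (by omega)]
    simp⟩

theorem single_last_mem_residueBlocks {n : ℕ} (hn : 0 < n) {c : ZMod p} (hc : c ≠ 0)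
    (R T : ZMod p) :
    c • Pi.single (Fin.last n) 1 ∈ residueBlocks p (n + 1) R T ↔ T = -n := by
  constructor
  · intro h
    obtain ⟨n, rfl⟩ := Nat.exists_eq_succ_of_ne_zero hn.ne'
    have := residueBlocks_recurrence h (Fin.last n)
    have hne : (Fin.last n).castSucc ≠ Fin.last (n + 1) := (Fin.castSucc_lt_last _).ne
    simp only [Fin.succ_last, Pi.smul_apply, Pi.single_eq_same, Pi.single_eq_of_ne hne, smul_eq_mul,
      mul_one, mul_zero, mul_eq_zero, hc, or_false, Fin.val_last] at this
    push_cast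
    linear_combination this
  · rintro rfl
    have hR := ZMod.val_lt R
    have hP : p + n < p ^ (p + n) := Nat.lt_pow_self (Fact.out : p.Prime).one_lt
    have hP0 : ((p ^ (p + n) : ℕ) : ZMod p) = 0 := by
      simp [(Fact.out : p.Prime).ne_zero]
    -- with `P = p ^ (p + n)`, row `P * c + R` starts with row `R`, zeros, and `c` at position `P`
    refine ⟨p ^ (p + n) * c.val + R.val, p ^ (p + n) - n, ?_, ?_, fun j => ?_⟩
    · rw [Nat.cast_add, Nat.cast_mul, hP0]
      simp
    · rw [Nat.cast_sub (by omega), hP0, zero_sub]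
    · rcases Fin.eq_castSucc_or_eq_last j with ⟨j, rfl⟩ | rfl
      · have h := choose_pow_mul_add_cast (p := p) (p + n) c.val 0 (r := R.val)
          (v := p ^ (p + n) - n + j) (by omega) (by omega)
        rw [mul_zero, zero_add] at h
        rw [Fin.val_castSucc, h, Nat.choose_eq_zero_of_lt (n := R.val) (by omega)]
        simp
      · have h := choose_pow_mul_add_cast (p := p) (p + n) c.val 1 (r := R.val) (v := 0)
          (by omega) (by omega)
        rw [mul_one, add_zero] at h
        rw [Fin.val_last, Nat.sub_add_cancel (by omega), h]
        simp

theorem single_zero_mem_residueBlocks {n : ℕ} (hn : 0 < n) {c : ZMod p} (hc : c ≠ 0)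
    (R T : ZMod p) :
    c • Pi.single (0 : Fin (n + 1)) 1 ∈ residueBlocks p (n + 1) R T ↔ R = T := by
  constructor
  · intro h
    obtain ⟨n, rfl⟩ := Nat.exists_eq_succ_of_ne_zero hn.ne'
    have := residueBlocks_recurrence h 0
    have hne : (0 : Fin (n + 1)).succ ≠ 0 := Fin.succ_ne_zero _
    simp only [Fin.castSucc_zero, Pi.smul_apply, Pi.single_eq_same, Pi.single_eq_of_ne hne,
      smul_eq_mul, mul_one, mul_zero, zero_eq_mul, hc, or_false, Fin.val_zero, Nat.cast_zero,
      sub_zero] at this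
    exact sub_eq_zero.1 this
  · rintro rfl
    have hR := ZMod.val_lt R
    have hP : p + n < p ^ (p + n) := Nat.lt_pow_self (Fact.out : p.Prime).one_lt
    have hP0 : ((p ^ (p + n) : ℕ) : ZMod p) = 0 := by
      simp [(Fact.out : p.Prime).ne_zero]
    -- the last entry of the copy of `c` times row `R` that starts at position `p ^ (p + n)`
    refine ⟨p ^ (p + n) * c.val + R.val, p ^ (p + n) * 1 + R.val, ?_, ?_, fun j => ?_⟩
    · rw [Nat.cast_add, Nat.cast_mul, hP0]
      simp
    · rw [Nat.cast_add, Nat.cast_mul, hP0]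
      simp
    · rw [add_assoc, choose_pow_mul_add_cast (p := p) _ _ _ (by omega) (by omega)]
      rcases Fin.eq_zero_or_eq_succ j with rfl | ⟨j, rfl⟩
      · simp
      · rw [Nat.choose_eq_zero_of_lt (n := R.val) (by simp)]
        simp

theorem alternating_mem_residueBlocks {n : ℕ} (hn : 0 < n) {c : ZMod p} (hc : c ≠ 0)
    (R T : ZMod p) :
    c • alternatingBlock p (n + 1) ∈ residueBlocks p (n + 1) R T ↔ R = -1 := by
  constructor
  · intro h
    obtain ⟨n, rfl⟩ := Nat.exists_eq_succ_of_ne_zero hn.ne'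
    have := residueBlocks_recurrence h 0
    simp only [alternatingBlock, Fin.castSucc_zero, Pi.smul_apply, smul_eq_mul, Fin.val_zero,
      Nat.cast_zero, Fin.val_succ, pow_zero, pow_succ] at this
    have h' : c * (R + 1) = 0 := by linear_combination -this
    rcases mul_eq_zero.1 h' with h' | h'
    · exact absurd h' hc
    · exact eq_neg_of_add_eq_zero_left h'
  · rintro rfl
    have hT := ZMod.val_lt T
    have hP : p + n < p ^ (p + n) := Nat.lt_pow_self (Fact.out : p.Prime).one_lt
    have hP0 : ((p ^ (p + n) : ℕ) : ZMod p) = 0 := by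
      simp [(Fact.out : p.Prime).ne_zero]
    -- row `p ^ (p + n) - 1` alternates; the factor `(-1) ^ T.val` adjusts the sign at position `T.val`
    refine ⟨p ^ (p + n) * (c * (-1) ^ T.val).val + (p ^ (p + n) - 1), p ^ (p + n) * 1 + T.val,
      ?_, ?_, fun j => ?_⟩
    · rw [Nat.cast_add, Nat.cast_mul, hP0, Nat.cast_sub (by omega), hP0]
      simp
    · rw [Nat.cast_add, Nat.cast_mul, hP0]
      simp
    · rw [add_assoc, choose_pow_mul_add_cast (p := p) _ _ _ (by omega) (by omega),
        choose_pow_sub_one_cast _ (by omega), Nat.choose_one_right, ZMod.natCast_zmod_val, pow_add,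
        mul_assoc, ← mul_assoc ((-1) ^ T.val), ← mul_pow]
      simp [alternatingBlock]

/-- A block with two different pairs of residues satisfies two of the linear recurrences
`residueBlocks_recurrence`. Their difference has constant coefficients, so the block is geometric or
supported at one end, and then the recurrence forces the ratio to be `-1`. -/
theorem eq_of_mem_residueBlocks {n : ℕ} (hn : 2 ≤ n) {R T R' T' : ZMod p}
    {b : Fin (n + 1) → ZMod p} (hb : b ∈ residueBlocks p (n + 1) R T)
    (hb' : b ∈ residueBlocks p (n + 1) R' T') (h0 : b ≠ 0)
    (hlast : b ∉ nonzeroMultiples (Pi.single (Fin.last n) 1))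
    (hfirst : b ∉ nonzeroMultiples (Pi.single 0 1))
    (halt : b ∉ nonzeroMultiples (alternatingBlock p (n + 1))) : R = R' ∧ T = T' := by
  have hdiff : ∀ j : Fin n, (T - T') * b j.succ = ((R - R') - (T - T')) * b j.castSucc := fun j => by
    linear_combination residueBlocks_recurrence hb j - residueBlocks_recurrence hb' j
  by_cases hT : T = T'
  · refine ⟨?_, hT⟩
    by_contra hR
    have hz : ∀ j : Fin n, b j.castSucc = 0 := fun j => by
      have := hdiff j
      rw [hT, sub_self, zero_mul, sub_zero, zero_eq_mul] at this
      exact this.resolve_left (sub_ne_zero.2 hR)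
    have hbl : b = b (Fin.last n) • Pi.single (Fin.last n) 1 := by
      funext j
      rcases Fin.eq_castSucc_or_eq_last j with ⟨j, rfl⟩ | rfl
      · simp [hz]
      · simp
    exact hlast ⟨_, fun h => h0 (by rw [hbl, h, zero_smul]), hbl⟩
  · exfalso
    have hT' : T - T' ≠ 0 := sub_ne_zero.2 hT
    by_cases hRT : (R - R') - (T - T') = 0
    · have hz : ∀ j : Fin n, b j.succ = 0 := fun j => by
        have := hdiff j
        rw [hRT, zero_mul, mul_eq_zero] at this
        exact this.resolve_left hT'
      have hbl : b = b 0 • Pi.single 0 1 := by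
        funext j
        rcases Fin.eq_zero_or_eq_succ j with rfl | ⟨j, rfl⟩
        · simp
        · simp [hz]
      exact hfirst ⟨_, fun h => h0 (by rw [hbl, h, zero_smul]), hbl⟩
    · obtain ⟨l, hl⟩ : ∃ l, l = ((R - R') - (T - T')) / (T - T') := ⟨_, rfl⟩
      have hl0 : l ≠ 0 := hl ▸ div_ne_zero hRT hT'
      have hgeo : ∀ j : Fin n, b j.succ = l * b j.castSucc := fun j => by
        rw [hl, div_mul_eq_mul_div, eq_div_iff hT', ← hdiff j, mul_comm]
      have hpow : ∀ j : Fin (n + 1), b j = b 0 * l ^ (j : ℕ) := fun j => by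
        induction j using Fin.induction with
        | zero => simp
        | succ j ih =>
          rw [hgeo, ih, Fin.val_succ, Fin.val_castSucc, pow_succ]
          ring
      have hb0 : b 0 ≠ 0 := fun h => h0 (funext fun j => by rw [hpow, h, zero_mul]; rfl)
      have hlin : ∀ j : Fin n, (T + (j : ℕ) + 1) * l = R - T - (j : ℕ) := fun j => by
        have h1 := residueBlocks_recurrence hb j
        have h2 : b j.castSucc ≠ 0 := by
          rw [hpow]
          exact mul_ne_zero hb0 (pow_ne_zero _ hl0)
        rw [hgeo] at h1
        exact mul_right_cancel₀ h2 (by linear_combination h1)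
      have hl1 : l = -1 := by
        have e0 := hlin ⟨0, by omega⟩
        have e1 := hlin ⟨1, by omega⟩
        push_cast at e0 e1
        linear_combination e1 - e0
      exact halt ⟨b 0, hb0, funext fun j => by rw [hpow, hl1]; rfl⟩

theorem mem_binomBlocks_iff {m : ℕ} {b : Fin m → ZMod p} :
    b ∈ binomBlocks p m ↔ ∃ x : ZMod p × ZMod p, b ∈ residueBlocks p m x.1 x.2 :=
  ⟨fun ⟨k, i, h⟩ => ⟨(k, i), k, i, rfl, rfl, h⟩, fun ⟨_, k, i, _, _, h⟩ => ⟨k, i, h⟩⟩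

open Classical in
/-- The number of pairs of residues that a block admits: `p ^ 2` for the zero block, `p` for the
multiples of the other three exceptional blocks, and `1` for all other accessible blocks. -/
theorem card_residues {n : ℕ} (hn : 2 ≤ n) (b : Fin (n + 1) → ZMod p) :
    ∑ x : ZMod p × ZMod p, (if b ∈ residueBlocks p (n + 1) x.1 x.2 then (1 : ℤ) else 0) =
      (if b ∈ binomBlocks p (n + 1) then 1 else 0)
      + ((p : ℤ) ^ 2 - 1) * (if b = 0 then 1 else 0)
      + ((p : ℤ) - 1) * (if b ∈ nonzeroMultiples (Pi.single (Fin.last n) 1) then 1 else 0)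
      + ((p : ℤ) - 1) * (if b ∈ nonzeroMultiples (Pi.single 0 1) then 1 else 0)
      + ((p : ℤ) - 1) * (if b ∈ nonzeroMultiples (alternatingBlock p (n + 1)) then 1 else 0) := by
  obtain ⟨n, rfl⟩ : ∃ n', n = n' + 2 := ⟨n - 2, by omega⟩
  -- the exceptional blocks are told apart by their entries with index `0`, `1` and `n + 2`
  have hlast0 : ∀ b, b ∈ nonzeroMultiples (p := p) (Pi.single (Fin.last (n + 2)) 1) →
      b 0 = 0 ∧ b (Fin.last _) ≠ 0 := by
    rintro _ ⟨c, hc, rfl⟩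
    have : (0 : Fin (n + 3)) ≠ Fin.last (n + 2) := (Fin.last_pos).ne
    simp [hc, this]
  have hfirst0 : ∀ b, b ∈ nonzeroMultiples (p := p) (Pi.single (0 : Fin (n + 3)) 1) →
      b 0 ≠ 0 ∧ b 1 = 0 := by
    rintro _ ⟨c, hc, rfl⟩
    simp [hc]
  have halt0 : ∀ b, b ∈ nonzeroMultiples (alternatingBlock p (n + 3)) → b 0 ≠ 0 ∧ b 1 ≠ 0 := by
    rintro _ ⟨c, hc, rfl⟩
    simp [hc, alternatingBlock]
  have hp : Fintype.card (ZMod p) = p := ZMod.card p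
  by_cases h0 : b = 0
  · subst h0
    have h1 : (0 : Fin (n + 3) → ZMod p) ∉ nonzeroMultiples (Pi.single (Fin.last (n + 2)) 1) :=
      fun h => (hlast0 _ h).2 rfl
    have h2 : (0 : Fin (n + 3) → ZMod p) ∉ nonzeroMultiples (Pi.single 0 1) :=
      fun h => (hfirst0 _ h).1 rfl
    have h3 : (0 : Fin (n + 3) → ZMod p) ∉ nonzeroMultiples (alternatingBlock p (n + 3)) :=
      fun h => (halt0 _ h).1 rfl
    have h4 : (0 : Fin (n + 3) → ZMod p) ∈ binomBlocks p (n + 3) :=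
      mem_binomBlocks_iff.2 ⟨(0, 0), zero_mem_residueBlocks _ _ _⟩
    simp [h1, h2, h3, h4, zero_mem_residueBlocks, hp, pow_two]
  by_cases h1 : b ∈ nonzeroMultiples (Pi.single (Fin.last (n + 2)) 1)
  · have h2 : b ∉ nonzeroMultiples (Pi.single 0 1) := fun h => (hfirst0 _ h).1 (hlast0 _ h1).1
    have h3 : b ∉ nonzeroMultiples (alternatingBlock p (n + 3)) :=
      fun h => (halt0 _ h).1 (hlast0 _ h1).1
    have hmem : ∀ R T, b ∈ residueBlocks p (n + 3) R T ↔ T = -((n + 2 : ℕ) : ZMod p) := by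
      obtain ⟨c, hc, rfl⟩ := h1
      exact single_last_mem_residueBlocks (by omega) hc
    have h4 : b ∈ binomBlocks p (n + 3) := mem_binomBlocks_iff.2 ⟨(0, _), (hmem _ _).2 rfl⟩
    rw [Fintype.sum_prod_type]
    simp [h0, h1, h2, h3, h4, hmem, hp]
  by_cases h2 : b ∈ nonzeroMultiples (Pi.single 0 1)
  · have h3 : b ∉ nonzeroMultiples (alternatingBlock p (n + 3)) :=
      fun h => (halt0 _ h).2 (hfirst0 _ h2).2
    have hmem : ∀ R T, b ∈ residueBlocks p (n + 3) R T ↔ R = T := by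
      obtain ⟨c, hc, rfl⟩ := h2
      exact single_zero_mem_residueBlocks (by omega) hc
    have h4 : b ∈ binomBlocks p (n + 3) := mem_binomBlocks_iff.2 ⟨(0, 0), (hmem _ _).2 rfl⟩
    rw [Fintype.sum_prod_type]
    simp [h0, h1, h2, h3, h4, hmem, hp]
  by_cases h3 : b ∈ nonzeroMultiples (alternatingBlock p (n + 3))
  · have hmem : ∀ R T, b ∈ residueBlocks p (n + 3) R T ↔ R = -1 := by
      obtain ⟨c, hc, rfl⟩ := h3
      exact alternating_mem_residueBlocks (by omega) hc
    have h4 : b ∈ binomBlocks p (n + 3) := mem_binomBlocks_iff.2 ⟨(-1, 0), (hmem _ _).2 rfl⟩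
    rw [Fintype.sum_prod_type_right]
    simp [h0, h1, h2, h3, h4, hmem, hp]
  by_cases h4 : b ∈ binomBlocks p (n + 3)
  · obtain ⟨x, hx⟩ := mem_binomBlocks_iff.1 h4
    have hmem : ∀ y : ZMod p × ZMod p, b ∈ residueBlocks p (n + 3) y.1 y.2 ↔ y = x := by
      refine fun y => ⟨fun hy => ?_, by rintro rfl; exact hx⟩
      exact Prod.ext_iff.2 (eq_of_mem_residueBlocks hn hy hx h0 h1 h2 h3)
    simp [h0, h1, h2, h3, h4, hmem]
  · have hmem : ∀ y : ZMod p × ZMod p, b ∉ residueBlocks p (n + 3) y.1 y.2 :=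
      fun y hy => h4 (mem_binomBlocks_iff.2 ⟨y, hy⟩)
    simp [h0, h1, h2, h3, h4, hmem]

open Classical in
theorem ncard_eq_sum_ite {α : Type*} [Fintype α] (s : Set α) :
    (s.ncard : ℤ) = ∑ b, if b ∈ s then 1 else 0 := by
  rw [Finset.sum_boole, Set.ncard_eq_toFinset_card']
  congr 2
  ext
  simp

theorem sum_ncard_residueBlocks {m : ℕ} (hm : 3 ≤ m) :
    ∑ x : ZMod p × ZMod p, ((residueBlocks p m x.1 x.2).ncard : ℤ) =
      (binomBlocks p m).ncard + ((p : ℤ) - 1) * (4 * p - 2) := by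
  classical
  obtain ⟨n, rfl⟩ : ∃ n, m = n + 1 := ⟨m - 1, by omega⟩
  have hp : 1 ≤ p := (Fact.out : p.Prime).one_le
  have hcard : ∀ {v : Fin (n + 1) → ZMod p}, v ≠ 0 →
      ∑ b, (if b ∈ nonzeroMultiples v then (1 : ℤ) else 0) = p - 1 := fun hv => by
    rw [← ncard_eq_sum_ite, ncard_nonzeroMultiples hv, Nat.cast_sub hp, Nat.cast_one]
  have h3 : alternatingBlock p (n + 1) ≠ 0 := fun h => by
    simpa [alternatingBlock] using congrFun h 0
  simp only [ncard_eq_sum_ite]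
  rw [Finset.sum_comm, Finset.sum_congr rfl fun b _ => card_residues (by omega) b]
  simp only [Finset.sum_add_distrib, ← Finset.mul_sum]
  rw [hcard (by simp), hcard (by simp), hcard h3, Finset.sum_ite_eq', if_pos (Finset.mem_univ _)]
  ring

end Multiplicity

/-! ### Recurrences for the number of blocks -/

/-- The number of accessible blocks of length `m`, as a real number. -/
noncomputable def blockCount (p m : ℕ) : ℝ := (binomBlocks p m).ncard

/-- The first difference of `blockCount`. -/
noncomputable def blockSlope (p m : ℕ) : ℝ := blockCount p (m + 1) - blockCount p m

theorem sum_ite_le {p t : ℕ} (ht : t ≤ p) (x y : ℝ) :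
    ∑ r ∈ Finset.range p, (if t ≤ r then x else y) = ((p : ℝ) - t) * x + t * y := by
  induction p, ht using Nat.le_induction with
  | base =>
    rw [Finset.sum_congr rfl fun r hr => if_neg (not_le.2 (Finset.mem_range.1 hr))]
    simp
  | succ p hp ih =>
    rw [Finset.sum_range_succ, ih, if_pos hp]
    push_cast
    ring

theorem two_mul_sum_range_linear (q : ℕ) (z x y : ℝ) :
    2 * ∑ t ∈ Finset.range q, ((z - t) * x + t * y) =
      2 * z * q * x - q * (q - 1) * (x - y) := by
  induction q with
  | zero => simp
  | succ q ih =>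
    rw [Finset.sum_range_succ, mul_add, ih]
    push_cast
    ring

theorem sum_zmod_val (p : ℕ) [NeZero p] (f : ℕ → ℝ) :
    ∑ z : ZMod p, f z.val = ∑ i ∈ Finset.range p, f i :=
  Finset.sum_bij' (fun z _ => z.val) (fun i _ => i)
    (fun z _ => Finset.mem_range.2 (ZMod.val_lt z)) (fun _ _ => Finset.mem_univ _)
    (fun z _ => ZMod.natCast_zmod_val z)
    (fun _ hi => ZMod.val_cast_of_lt (Finset.mem_range.1 hi)) (fun _ _ => rfl)

section Recurrence
variable {p : ℕ} [Fact p.Prime]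

/-- Both sides count the triples of a block and a pair of residues that it admits. -/
theorem blockCount_recurrence {m : ℕ} (hm : 3 ≤ m) :
    blockCount p m + ((p : ℝ) - 1) * (4 * p - 2) =
      ∑ t ∈ Finset.range p, (((p : ℝ) - t) * blockCount p ((m + t + p - 1) / p) +
        t * blockCount p ((m + t + p - 1) / p - 1)) := by
  have h := congrArg (Int.cast (R := ℝ)) (sum_ncard_residueBlocks (p := p) hm)
  push_cast at h
  rw [blockCount, ← h, Fintype.sum_prod_type_right]
  simp only [ncard_residueBlocks_eq (by omega : 0 < m)]
  rw [sum_zmod_val p fun t => ∑ R : ZMod p,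
    ((binomBlocks p (sourceLength p m R.val t)).ncard : ℝ)]
  refine Finset.sum_congr rfl fun t ht => ?_
  rw [sum_zmod_val p fun r => ((binomBlocks p (sourceLength p m r t)).ncard : ℝ),
    ← sum_ite_le (Finset.mem_range.1 ht).le]
  refine Finset.sum_congr rfl fun r _ => ?_
  by_cases htr : t ≤ r
  · rw [sourceLength, if_pos htr, if_pos htr, blockCount]
  · rw [sourceLength, if_neg htr, if_neg htr, blockCount]

/-- The excess of the count over residues is constant, so it disappears from the differences. -/
theorem blockSlope_mul_add_of_pos {n s : ℕ} (hs : 0 < s) (hsp : s ≤ p) (hm : 3 ≤ p * n + s) :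
    blockSlope p (p * n + s) = ((p : ℝ) - s) * blockSlope p n + s * blockSlope p (n + 1) := by
  have hp : 0 < p := (Fact.out : p.Prime).pos
  have h1 := blockCount_recurrence (p := p) hm
  have h2 := blockCount_recurrence (p := p) (m := p * n + s + 1) (by omega)
  have hd : ∀ c y, c * p ≤ y → y < (c + 1) * p → y / p = c := fun c y h h' =>
    Nat.div_eq_of_lt_le h h'
  have e1 : p * n = n * p := mul_comm _ _
  have hsum := Finset.sum_eq_single_of_mem (s := Finset.range p)
    (f := fun t : ℕ => (((p : ℝ) - t) * blockCount p ((p * n + s + 1 + t + p - 1) / p) +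
        t * blockCount p ((p * n + s + 1 + t + p - 1) / p - 1)) -
      (((p : ℝ) - t) * blockCount p ((p * n + s + t + p - 1) / p) +
        t * blockCount p ((p * n + s + t + p - 1) / p - 1))) (p - s)
    (Finset.mem_range.2 (by omega)) (fun t ht hts => by
      have ht := Finset.mem_range.1 ht
      -- the number of strings met changes only when the longer window enters a new string
      have : (p * n + s + 1 + t + p - 1) / p = (p * n + s + t + p - 1) / p := by
        rcases lt_or_ge (s + t) p with h | h
        · rw [hd (n + 1), hd (n + 1)] <;> simp only [add_mul] <;> omega
        · rw [hd (n + 2), hd (n + 2)] <;> simp only [add_mul] <;> omega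
      rw [this, sub_self])
  have e2 : (p * n + s + 1 + (p - s) + p - 1) / p = n + 2 := by
    apply hd <;> simp only [add_mul] <;> omega
  have e3 : (p * n + s + (p - s) + p - 1) / p = n + 1 := by
    apply hd <;> simp only [add_mul] <;> omega
  rw [Finset.sum_sub_distrib, ← h1, ← h2, e2, e3, Nat.cast_sub hsp] at hsum
  simp only [Nat.add_sub_cancel, show n + 2 - 1 = n + 1 from rfl] at hsum
  simp only [blockSlope]
  linear_combination hsum

theorem blockSlope_mul_add {n s : ℕ} (hsp : s ≤ p) (hm : 3 ≤ p * n + s) :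
    blockSlope p (p * n + s) = ((p : ℝ) - s) * blockSlope p n + s * blockSlope p (n + 1) := by
  rcases Nat.eq_zero_or_pos s with rfl | hs
  · obtain ⟨n, rfl⟩ := Nat.exists_eq_succ_of_ne_zero (n := n) (by rintro rfl; omega)
    have hp : 0 < p := (Fact.out : p.Prime).pos
    have := blockSlope_mul_add_of_pos (p := p) (n := n) hp le_rfl (by rw [← mul_add_one]; omega)
    rw [add_zero, Nat.succ_eq_add_one, mul_add_one, this]
    simp
  · exact blockSlope_mul_add_of_pos hs hsp hm

theorem blockCount_mul {n : ℕ} (hm : 3 ≤ p * n) :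
    2 * blockCount p (p * n) = 2 * (p : ℝ) ^ 2 * blockCount p n +
      p * (p - 1) * blockSlope p n - 2 * ((p - 1) * (4 * p - 2)) := by
  obtain ⟨q, hq⟩ : ∃ q, p = q + 1 := ⟨p - 1, by have := (Fact.out : p.Prime).pos; omega⟩
  have hp : 0 < p := by omega
  have h := blockCount_recurrence (p := p) hm
  have hd : ∀ c y, c * p ≤ y → y < (c + 1) * p → y / p = c := fun c y h h' =>
    Nat.div_eq_of_lt_le h h'
  have e1 : p * n = n * p := mul_comm _ _
  have h0 : (p * n + 0 + p - 1) / p = n :=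
    hd _ _ (by omega) (by rw [add_mul]; omega)
  have hsum : ∑ t ∈ Finset.range p,
      (((p : ℝ) - t) * blockCount p ((p * n + t + p - 1) / p) +
        t * blockCount p ((p * n + t + p - 1) / p - 1)) =
      ∑ t ∈ Finset.range p, (((p : ℝ) - t) * blockCount p (n + 1) + t * blockCount p n) -
        p * blockSlope p n := by
    rw [← Finset.add_sum_erase _ _ (Finset.mem_range.2 hp),
      ← Finset.add_sum_erase _ (fun t : ℕ => ((p : ℝ) - t) * blockCount p (n + 1) +
        t * blockCount p n) (Finset.mem_range.2 hp), h0,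
      Finset.sum_congr rfl fun t ht => ?_, blockSlope]
    · push_cast
      ring
    · have ht := Finset.mem_erase.1 ht
      have ht' := Finset.mem_range.1 ht.2
      have : (p * n + t + p - 1) / p = n + 1 := by
        apply hd <;> simp only [add_mul] <;> omega
      rw [this, Nat.add_sub_cancel]
  have h2 := two_mul_sum_range_linear p p (blockCount p (n + 1)) (blockCount p n)
  rw [blockSlope] at *
  linear_combination 2 * h + 2 * hsum + h2

theorem blockCount_zero : blockCount p 0 = 1 := by
  have : binomBlocks p 0 = Set.univ :=
    Set.eq_univ_of_forall fun b => ⟨0, 0, fun j => j.elim0⟩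
  rw [blockCount, this, Set.ncard_univ, Nat.card_eq_fintype_card]
  simp

theorem blockCount_one : blockCount p 1 = p := by
  have : binomBlocks p 1 = Set.univ :=
    Set.eq_univ_of_forall fun b => ⟨(b 0).val, 1, fun j => by
      obtain rfl := Subsingleton.elim j 0
      simp⟩
  rw [blockCount, this, Set.ncard_univ, Nat.card_eq_fintype_card]
  simp

/-- Every pair of residues is accessible: the pair `c, c * r` with `c ≠ 0` occurs at positions `p`
and `p + 1` of row `p * c + r`, and the pair `0, c` at positions `p - 1` and `p` of row `p * c`. -/
theorem blockCount_two : blockCount p 2 = (p : ℝ) ^ 2 := by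
  have hp : 1 < p := (Fact.out : p.Prime).one_lt
  have : binomBlocks p 2 = Set.univ := by
    refine Set.eq_univ_of_forall fun b => ?_
    by_cases h : b 0 = 0
    · refine ⟨p * (b 1).val + 0, p * 0 + (p - 1), fun j => ?_⟩
      fin_cases j
      · have := choose_mul_add_cast (p := p) (b 1).val 0 (r := 0) (v := p - 1) (by omega)
          (by omega)
        simp only [Fin.zero_eta, add_zero] at this ⊢
        rw [this, h, Nat.choose_eq_zero_of_lt (n := 0) (by omega)]
        simp
      · have := choose_mul_add_cast (p := p) (b 1).val 1 (r := 0) (v := 0) (by omega) (by omega)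
        have e : p * 0 + (p - 1) + 1 = p * 1 + 0 := by omega
        simp only [Fin.mk_one]
        rw [e, this]
        simp
    · refine ⟨p * (b 0).val + (b 1 / b 0).val, p * 1, fun j => ?_⟩
      rw [choose_mul_add_cast _ _ (ZMod.val_lt _) (by omega)]
      fin_cases j
      · simp
      · simp [mul_div_cancel₀ _ h]
  rw [blockCount, this, Set.ncard_univ, Nat.card_eq_fintype_card]
  simp [ZMod.card]

theorem blockCount_three (hp3 : 3 ≤ p) :
    blockCount p 3 = ((p : ℝ) ^ 3 + 4 * p ^ 2 - 5 * p + 2) / 2 := by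
  obtain ⟨q, hq⟩ : ∃ q, p = q + 2 := ⟨p - 2, by omega⟩
  have h := blockCount_recurrence (p := p) (m := 3) le_rfl
  have hd : ∀ c y, c * p ≤ y → y < (c + 1) * p → y / p = c := fun c y h h' =>
    Nat.div_eq_of_lt_le h h'
  have e0 : ∀ t < q, (3 + t + p - 1) / p = 1 := fun t ht => by
    apply hd <;> omega
  have e1 : (3 + q + p - 1) / p = 2 := by apply hd <;> omega
  have e2 : (3 + (q + 1) + p - 1) / p = 2 := by apply hd <;> omega
  have hr : Finset.range p = Finset.range (q + 2) := by rw [hq]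
  have h2 := two_mul_sum_range_linear q p (blockCount p 1) (blockCount p 0)
  have hqr : (q : ℝ) = p - 2 := by rw [hq]; push_cast; ring
  rw [hr, Finset.sum_range_succ, Finset.sum_range_succ, e1, e2,
    Finset.sum_congr rfl fun t ht => by rw [e0 t (Finset.mem_range.1 ht)]] at h
  simp only [Nat.sub_self, show 2 - 1 = 1 from rfl] at h
  push_cast at h
  rw [blockCount_zero, blockCount_one, hqr] at h2
  rw [blockCount_zero, blockCount_one, blockCount_two, hqr] at h
  linear_combination h + h2 / 2

theorem blockSlope_zero : blockSlope p 0 = p - 1 := by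
  rw [blockSlope, zero_add, blockCount_one, blockCount_zero]

theorem blockSlope_one : blockSlope p 1 = (p : ℝ) ^ 2 - p := by
  rw [blockSlope, one_add_one_eq_two, blockCount_one, blockCount_two]

theorem blockSlope_two (hp3 : 3 ≤ p) :
    blockSlope p 2 = ((p : ℝ) ^ 3 + 2 * p ^ 2 - 5 * p + 2) / 2 := by
  rw [blockSlope, show 2 + 1 = 3 from rfl, blockCount_three hp3, blockCount_two]
  ring

theorem blockSlope_of_le {c : ℕ} (hc : 3 ≤ c) (hcp : c ≤ p) :
    blockSlope p c = (p - 1) * (p + c * (p - 1)) := by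
  have h := blockSlope_mul_add (p := p) (n := 0) hcp (by omega)
  rw [mul_zero, zero_add, zero_add, blockSlope_zero, blockSlope_one] at h
  rw [h]
  ring

/-! ### The block count between multiples of a power of `p` -/

/-- The slope interpolates linearly between consecutive multiples of `p ^ k`. -/
theorem blockSlope_pow_mul_add (hp3 : 3 ≤ p) {c : ℕ} (hc : 1 ≤ c) (k : ℕ) {s : ℕ}
    (hs : s ≤ p ^ k) :
    blockSlope p (p ^ k * c + s) =
      ((p : ℝ) ^ k - s) * blockSlope p c + s * blockSlope p (c + 1) := by
  induction k generalizing s with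
  | zero =>
    rw [pow_zero] at hs
    interval_cases s <;> simp
  | succ k ih =>
    have hp : 0 < p := by omega
    have hpos : 1 ≤ p ^ k * c + s / p :=
      (Nat.mul_pos (pow_pos hp k) hc).trans_le (Nat.le_add_right _ _)
    have hle : p ≤ p * (p ^ k * c + s / p) := Nat.le_mul_of_pos_right p hpos
    have hkey : p ^ (k + 1) * c + s = p * (p ^ k * c + s / p) + s % p := by
      rw [pow_succ', mul_add, mul_assoc, add_assoc, Nat.div_add_mod]
    have hdiv : s / p ≤ p ^ k := Nat.div_le_of_le_mul (by rwa [pow_succ'] at hs)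
    have hcast : (s : ℝ) = p * (s / p : ℕ) + (s % p : ℕ) := by
      exact_mod_cast (Nat.div_add_mod s p).symm
    rw [hkey, blockSlope_mul_add (Nat.mod_lt _ hp).le (by omega), ih hdiv]
    rcases hdiv.lt_or_eq with hlt | heq
    · rw [add_assoc, ih hlt, hcast]
      push_cast
      ring
    · have h0 : s % p = 0 := by
        have h1 := Nat.div_add_mod s p
        rw [heq, ← pow_succ'] at h1
        omega
      rw [h0] at hcast ⊢
      rw [hcast, heq]
      push_cast
      ring

/-- If the slope is affine on `[c, c + w]` with increment `E`, then the block count is quadratic on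
`[p ^ k * c, p ^ k * (c + w)]`. -/
theorem blockCount_pow_mul_add (hp3 : 3 ≤ p) {c w : ℕ} {E : ℝ} (hc : 1 ≤ c)
    (hE : ∀ u ≤ w, blockSlope p (c + u) = blockSlope p c + u * E) (k : ℕ) {s : ℕ}
    (hs : s ≤ p ^ k * w) :
    2 * blockCount p (p ^ k * c + s) = 2 * blockCount p (p ^ k * c) +
      2 * s * (p ^ k * blockSlope p c) + s * (s - 1) * E := by
  have hP : 0 < p ^ k := pow_pos (by omega) k
  induction s with
  | zero => simp
  | succ s ih =>
    have hlt : s / p ^ k < w := Nat.div_lt_of_lt_mul hs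
    have hslope := blockSlope_pow_mul_add hp3 (c := c + s / p ^ k)
      (hc.trans (Nat.le_add_right _ _)) k
      (Nat.mod_lt s hP).le
    rw [mul_add, add_assoc, Nat.div_add_mod, add_assoc c, hE _ hlt.le, hE _ hlt] at hslope
    have hcast : (s : ℝ) = p ^ k * (s / p ^ k : ℕ) + (s % p ^ k : ℕ) := by
      exact_mod_cast (Nat.div_add_mod s (p ^ k)).symm
    rw [blockSlope] at hslope
    push_cast at hslope ⊢
    rw [← add_assoc]
    linear_combination ih (by omega) + 2 * hslope - 2 * E * hcast

theorem blockCount_pow_mul_succ (hp3 : 3 ≤ p) {c k : ℕ} {E α β z : ℝ} (hc : 1 ≤ c)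
    (hE : ∀ u ≤ 1, blockSlope p (c + u) = blockSlope p c + u * E)
    (hstart : blockCount p (p ^ k * c) = α * ((p : ℝ) ^ k) ^ 2 + β * p ^ k + z) :
    blockCount p (p ^ k * (c + 1)) =
      (α + blockSlope p c + E / 2) * ((p : ℝ) ^ k) ^ 2 + (β - E / 2) * p ^ k + z := by
  have h := blockCount_pow_mul_add hp3 hc hE k (s := p ^ k) (by omega)
  rw [mul_add_one]
  push_cast at h
  linear_combination h / 2 + hstart

/-- The leading coefficient of `blockCount p (p ^ k)` as a quadratic polynomial in `p ^ k`. -/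
noncomputable def leadingCoeffPow (p : ℕ) : ℝ :=
  p + ((p : ℝ) ^ 2 - p) / 2 - (4 * p - 2) / (p + 1)

theorem blockCount_pow (hp3 : 3 ≤ p) (k : ℕ) :
    blockCount p (p ^ k) = leadingCoeffPow p * ((p : ℝ) ^ k) ^ 2
      - ((p : ℝ) ^ 2 - p) / 2 * p ^ k + (4 * p - 2) / (p + 1) := by
  have hp1 : (p : ℝ) + 1 ≠ 0 := by positivity
  induction k with
  | zero =>
    rw [pow_zero, blockCount_one, leadingCoeffPow]
    ring
  | succ k ih =>
    have hpos : 0 < p ^ k := pow_pos (by omega) k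
    have hle : p ≤ p * p ^ k := Nat.le_mul_of_pos_right p hpos
    have h := blockCount_mul (p := p) (n := p ^ k) (by omega)
    have hs := blockSlope_pow_mul_add hp3 le_rfl k (Nat.zero_le _)
    rw [mul_one, add_zero, blockSlope_one] at hs
    rw [hs, ih] at h
    have hfrac : (4 * (p : ℝ) - 2) / (p + 1) * (p + 1) = 4 * p - 2 := div_mul_cancel₀ _ hp1
    rw [pow_succ']
    push_cast at h ⊢
    linear_combination h / 2 + ((p : ℝ) - 1) * hfrac

end Recurrence

/-! ### Limits along `⌊p ^ k / x⌋` -/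

/-- Only the quadratic part matters, because `p ^ k / ⌊p ^ k / x⌋` tends to `x`. -/
theorem tendsto_div_sq_of_quadratic {p : ℕ} (hp : 1 < p) {x : ℝ} (hx : 0 < x) {f : ℕ → ℝ}
    {q₁ q₂ q₃ l₁ l₂ z : ℝ}
    (hf : ∀ k : ℕ, f ⌊(p : ℝ) ^ k / x⌋₊ = q₁ * (⌊(p : ℝ) ^ k / x⌋₊ : ℝ) ^ 2 +
      q₂ * (⌊(p : ℝ) ^ k / x⌋₊ : ℝ) * p ^ k + q₃ * ((p : ℝ) ^ k) ^ 2 +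
      l₁ * (⌊(p : ℝ) ^ k / x⌋₊ : ℝ) + l₂ * p ^ k + z) :
    Tendsto (fun k : ℕ => f ⌊(p : ℝ) ^ k / x⌋₊ / (⌊(p : ℝ) ^ k / x⌋₊ : ℝ) ^ 2) atTop
      (𝓝 (q₁ + q₂ * x + q₃ * x ^ 2)) := by
  have hP : Tendsto (fun k : ℕ => (p : ℝ) ^ k) atTop atTop :=
    tendsto_pow_atTop_atTop_of_one_lt (by exact_mod_cast hp)
  have hN : Tendsto (fun k : ℕ => (⌊(p : ℝ) ^ k / x⌋₊ : ℝ)) atTop atTop :=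
    tendsto_natCast_atTop_atTop.comp (tendsto_nat_floor_atTop.comp (hP.atTop_div_const hx))
  have hinv : Tendsto (fun k : ℕ => (⌊(p : ℝ) ^ k / x⌋₊ : ℝ)⁻¹) atTop (𝓝 0) :=
    tendsto_inv_atTop_zero.comp hN
  have hratio : Tendsto (fun k : ℕ => (p : ℝ) ^ k * (⌊(p : ℝ) ^ k / x⌋₊ : ℝ)⁻¹) atTop (𝓝 x) := by
    have h := ((tendsto_nat_floor_mul_div_atTop (inv_nonneg.2 hx.le)).comp hP).inv₀
      (inv_ne_zero hx.ne')
    rw [inv_inv] at h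
    refine h.congr fun k => ?_
    simp only [Function.comp_apply]
    rw [inv_div, div_eq_mul_inv, inv_mul_eq_div]
  have hlim := ((((tendsto_const_nhds (x := q₁)).add (hratio.const_mul q₂)).add
    ((hratio.pow 2).const_mul q₃)).add (hinv.const_mul l₁)).add
    (((hratio.mul hinv).const_mul l₂).add ((hinv.pow 2).const_mul z))
  have hval : q₁ + q₂ * x + q₃ * x ^ 2 =
      q₁ + q₂ * x + q₃ * x ^ 2 + l₁ * 0 + (l₂ * (x * 0) + z * 0 ^ 2) := by ring
  rw [hval]
  refine hlim.congr' ?_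
  filter_upwards [hN.eventually_gt_atTop 0] with k hk
  rw [hf]
  field_simp
  ring

/-- The limit for `c ≤ 1 / x ≤ c + w`, if the slope is affine on `[c, c + w]` with increment `E` and
the block count at `p ^ k * c` is a quadratic polynomial in `p ^ k`. -/
theorem tendsto_blockCount {p : ℕ} [Fact p.Prime] (hp3 : 3 ≤ p) {x : ℝ} (hx : 0 < x) {c w : ℕ}
    {E α β z : ℝ} (hc : 1 ≤ c)
    (hE : ∀ u ≤ w, blockSlope p (c + u) = blockSlope p c + u * E)
    (hstart : ∀ k : ℕ, blockCount p (p ^ k * c) = α * ((p : ℝ) ^ k) ^ 2 + β * p ^ k + z)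
    (hlow : c * x ≤ 1) (hhigh : 1 ≤ (c + w : ℝ) * x) :
    Tendsto (fun k : ℕ => (lineComplexity (1 + X) p ⌊(p : ℝ) ^ k / x⌋₊ : ℝ) /
        (⌊(p : ℝ) ^ k / x⌋₊ : ℝ) ^ 2) atTop
      (𝓝 (E / 2 + (blockSlope p c - c * E) * x +
        (α - c * blockSlope p c + c ^ 2 * E / 2) * x ^ 2)) := by
  simp only [lineComplexity_eq]
  refine tendsto_div_sq_of_quadratic (f := blockCount p) (by omega) hx (l₁ := -E / 2)
    (l₂ := β + c * E / 2) (z := z) fun k => ?_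
  have hP : (0 : ℝ) < (p : ℝ) ^ k := pow_pos (by exact_mod_cast (by omega : 0 < p)) k
  have h1 : p ^ k * c ≤ ⌊(p : ℝ) ^ k / x⌋₊ := by
    apply Nat.le_floor
    rw [le_div_iff₀ hx]
    push_cast
    nlinarith
  have h2 : ⌊(p : ℝ) ^ k / x⌋₊ ≤ p ^ k * c + p ^ k * w := by
    apply Nat.floor_le_of_le
    rw [div_le_iff₀ hx]
    push_cast
    nlinarith
  obtain ⟨s, hs⟩ := Nat.exists_eq_add_of_le h1
  have h := blockCount_pow_mul_add hp3 hc hE k (s := s) (by omega)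
  rw [hs, eq_div_of_mul_eq two_ne_zero ((mul_comm _ _).trans h), hstart]
  push_cast
  ring

theorem mainTheorem1 (p : ℕ) (hp : p.Prime) (hp3 : 3 ≤ p) (x : ℝ)
    (hx0 : 1 / (p : ℝ) ≤ x) (hx1 : x ≤ 1) :
    (x ≤ 1 / 3 → p ≠ 5 →
      Tendsto (fun k : ℕ => (lineComplexity (1 + X) p ⌊(p : ℝ) ^ k / x⌋₊ : ℝ) /
          (⌊(p : ℝ) ^ k / x⌋₊ : ℝ) ^ 2) atTop
        (𝓝 ((p : ℝ) ^ 2 * ((p : ℝ) - 5) * ((p : ℝ) - 1) / (2 * ((p : ℝ) + 1)) *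
              (x + ((p : ℝ) + 1) / ((p : ℝ) * ((p : ℝ) - 5))) ^ 2
            + ((p : ℝ) - 1) * ((p : ℝ) ^ 2 - 7 * p + 4) / (2 * ((p : ℝ) - 5))))) ∧
    (x ≤ 1 / 3 → p = 5 →
      Tendsto (fun k : ℕ => (lineComplexity (1 + X) p ⌊(p : ℝ) ^ k / x⌋₊ : ℝ) /
          (⌊(p : ℝ) ^ k / x⌋₊ : ℝ) ^ 2) atTop
        (𝓝 (20 * x + 8))) ∧
    (1 / 3 ≤ x → x ≤ 1 / 2 →
      Tendsto (fun k : ℕ => (lineComplexity (1 + X) p ⌊(p : ℝ) ^ k / x⌋₊ : ℝ) /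
          (⌊(p : ℝ) ^ k / x⌋₊ : ℝ) ^ 2) atTop
        (𝓝 (-((p : ℝ) - 1) * (7 * (p : ℝ) ^ 3 - 8 * (p : ℝ) ^ 2 - 9 * p + 18) /
                (4 * ((p : ℝ) + 1)) *
              (x - ((p : ℝ) + 1) * (3 * (p : ℝ) ^ 2 - 7 * p + 6) /
                (7 * (p : ℝ) ^ 3 - 8 * (p : ℝ) ^ 2 - 9 * p + 18)) ^ 2
            + ((p : ℝ) - 1) * ((p : ℝ) ^ 5 + 5 * (p : ℝ) ^ 4 - 8 * (p : ℝ) ^ 3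
                - 15 * (p : ℝ) ^ 2 + 39 * p - 18) /
              (2 * (7 * (p : ℝ) ^ 3 - 8 * (p : ℝ) ^ 2 - 9 * p + 18))))) ∧
    (1 / 2 ≤ x →
      Tendsto (fun k : ℕ => (lineComplexity (1 + X) p ⌊(p : ℝ) ^ k / x⌋₊ : ℝ) /
          (⌊(p : ℝ) ^ k / x⌋₊ : ℝ) ^ 2) atTop
        (𝓝 (((p : ℝ) - 2) * ((p : ℝ) - 1) * ((p : ℝ) ^ 2 + 2 * p + 5) / (4 * ((p : ℝ) + 1)) *
              (x - ((p : ℝ) + 1) ^ 2 / ((p : ℝ) ^ 2 + 2 * p + 5)) ^ 2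
            + ((p : ℝ) - 1) * ((p : ℝ) ^ 3 + 4 * (p : ℝ) ^ 2 + 3 * p - 4) /
              (2 * ((p : ℝ) ^ 2 + 2 * p + 5))))) := by
  have : Fact p.Prime := ⟨hp⟩
  have hp3' : (3 : ℝ) ≤ p := by exact_mod_cast hp3
  have hp1 : (p : ℝ) + 1 ≠ 0 := by positivity
  have hx : 0 < x := lt_of_lt_of_le (by positivity) hx0
  have hpx : 1 ≤ p * x := by rwa [div_le_iff₀' (by positivity)] at hx0
  -- the increments of the slope on `[1, 2]`, `[2, 3]` and `[3, p]`
  have hE1 : ∀ u ≤ 1, blockSlope p (1 + u) =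
      blockSlope p 1 + u * (((p : ℝ) - 1) ^ 2 * (p + 2) / 2) := fun u hu => by
    interval_cases u
    · simp
    · rw [show 1 + 1 = 2 from rfl, blockSlope_two hp3, blockSlope_one]
      push_cast
      ring
  have hE2 : ∀ u ≤ 1, blockSlope p (2 + u) =
      blockSlope p 2 + u * (-((p : ℝ) - 1) ^ 2 * (p - 4) / 2) := fun u hu => by
    interval_cases u
    · simp
    · rw [show 2 + 1 = 3 from rfl, blockSlope_two hp3, blockSlope_of_le le_rfl hp3]
      push_cast
      ring
  have hE3 : ∀ u ≤ p - 3, blockSlope p (3 + u) =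
      blockSlope p 3 + u * ((p : ℝ) - 1) ^ 2 := fun u hu => by
    rw [blockSlope_of_le (by omega) (by omega), blockSlope_of_le le_rfl hp3]
    push_cast
    ring
  have h1 : ∀ k : ℕ, blockCount p (p ^ k * 1) = _ * ((p : ℝ) ^ k) ^ 2 + _ * p ^ k + _ := fun k => by
    rw [mul_one, blockCount_pow hp3, sub_eq_add_neg, ← neg_mul]
  have h2 : ∀ k : ℕ, blockCount p (p ^ k * 2) = _ * ((p : ℝ) ^ k) ^ 2 + _ * p ^ k + _ :=
    fun k => blockCount_pow_mul_succ hp3 le_rfl hE1 (h1 k)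
  have h3 : ∀ k : ℕ, blockCount p (p ^ k * 3) = _ * ((p : ℝ) ^ k) ^ 2 + _ * p ^ k + _ :=
    fun k => blockCount_pow_mul_succ hp3 one_le_two hE2 (h2 k)
  have hcast : ((3 : ℕ) : ℝ) + (p - 3 : ℕ) = p := by
    rw [Nat.cast_sub hp3]
    push_cast
    ring
  refine ⟨fun hx3 hp5 => ?_, fun hx3 hp5 => ?_, fun hx3 hx2 => ?_, fun hx2 => ?_⟩
  · have h := tendsto_blockCount hp3 hx (by norm_num) hE3 h3 (by push_cast; linarith)
      (by rwa [hcast])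
    convert h using 2
    rw [blockSlope_of_le le_rfl hp3, blockSlope_two hp3, blockSlope_one, leadingCoeffPow]
    have h5 : (p : ℝ) - 5 ≠ 0 := sub_ne_zero.2 (by exact_mod_cast hp5)
    push_cast
    field_simp
    ring
  · have h := tendsto_blockCount hp3 hx (by norm_num) hE3 h3 (by push_cast; linarith)
      (by rwa [hcast])
    convert h using 2
    rw [blockSlope_of_le le_rfl hp3, blockSlope_two hp3, blockSlope_one, leadingCoeffPow, hp5]
    norm_num
    ring
  · have h := tendsto_blockCount hp3 hx one_le_two hE2 h2 (by push_cast; linarith)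
      (by push_cast; linarith)
    convert h using 2
    rw [blockSlope_two hp3, blockSlope_one, leadingCoeffPow]
    have hD : 7 * (p : ℝ) ^ 3 - 8 * (p : ℝ) ^ 2 - 9 * p + 18 ≠ 0 := by
      have : 0 < 7 * (p : ℝ) ^ 3 - 8 * (p : ℝ) ^ 2 - 9 * p + 18 := by
        nlinarith [mul_nonneg (sq_nonneg (p : ℝ)) (sub_nonneg.2 hp3'), sq_nonneg ((p : ℝ) - 3)]
      exact this.ne'
    -- `field_simp` would factor the cubic partially, so it is made an atom first
    generalize hDdef : 7 * (p : ℝ) ^ 3 - 8 * (p : ℝ) ^ 2 - 9 * p + 18 = D at hD ⊢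
    push_cast
    field_simp
    rw [← hDdef]
    ring
  · have h := tendsto_blockCount hp3 hx le_rfl hE1 h1 (by push_cast; linarith)
      (by push_cast; linarith)
    convert h using 2
    rw [blockSlope_one, leadingCoeffPow]
    have hD : (p : ℝ) ^ 2 + 2 * p + 5 ≠ 0 := by positivity
    push_cast
    field_simp
    ring
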